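/- All spaces are completely regular and Hausdorff, and $\mathcal K(X)$ denotes the family of all compact subsets of $X$ (including $\varnothing$). A set $A\subset Y$ is bounded in $Y$ if every continuous function $Y\to\mathbb R$ is bounded on $A$; $Y$ is a $\mu$-space if every closed bounded subset of $Y$ is compact. A space is Čech-complete if it is a $G_\delta$-set in its Stone–Čech compactification. A sieve on $Y$ is a sequence of open covers $\{U_\alpha:\alpha\in A_n\}_{n\in\mathbb N}$ of $Y$ together with maps $\pi_n:A_{n+1}\to A_n$ such that $U_\alpha=\bigcup\{U_\beta:\beta\in\pi_n^{-1}(\alpha)\}$ for all $n$ and $\alpha\in A_n$. It is complete if, whenever $\alpha_n\in A_n$ and $\pi_n(\alpha_{n+1})=\alpha_n$ for all $n$, every filter base on $Y$ each of whose members meets every $U_{\alpha_n}$ has a cluster point in $Y$. A space is sieve-complete if it has a complete sieve. Let $\mathcal T(X)$ be the topology of $X$. A map $F:\mathcal K(X)\to\mathcal K(Y)$ is monotone if $K\subset L$ implies $F(K)\subset F(L)$, and it is set tri-quotient if there is a map $s:\mathcal T(X)\to\mathcal T(Y)$ such that 1. $s(U)\subset\bigcup\{F(K):K\in\mathcal K(X),\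 K\subset U\}$ for all $U\in\mathcal T(X)$; 2. $s(X)=Y$; 3. $U\subset V$ implies $s(U)\subset s(V)$; 4. if $y\in s(U)$ and $\mathcal W$ is a family of open subsets of $X$ that covers $\bigcup\{K\in\mathcal K(X): y\in F(K),\ K\subset U\}$, then $y\in s(\bigcup\mathcal E)$ for some finite $\mathcal E\subset\mathcal W$. **Corollary 3.7.** For a $\mu$-space $Y$ the following are equivalent: (a) $Y$ is sieve-complete; (b) there exist a paracompact Čech-complete space $X$ and an open (not necessarily continuous) surjection $f:X\to Y$ such that $f(K)$ has compact closure in $Y$ for every $K\in\mathcal K(X)$; (c) there exist a paracompact Čech-complete space $X$ and a monotone set tri-quotient map $F:\mathcal K(X)\to\mathcal K(Y)$. -/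

import Mathlib

open Set TopologicalSpace

universe u

/-- A set `A` is bounded in the space `X` if every continuous real-valued function on `X` is
bounded on `A`. -/
def IsFunctionallyBounded {X : Type*} [TopologicalSpace X] (A : Set X) : Prop :=
  ∀ f : X → ℝ, Continuous f → Bornology.IsBounded (f '' A)

/-- `X` is a `μ`-space if every closed and bounded subset of `X` is compact. -/
def IsMuSpace (X : Type*) [TopologicalSpace X] : Prop :=
  ∀ A : Set X, IsClosed A → IsFunctionallyBounded A → IsCompact A

/-- A Čech-complete space: a Tychonoff space which is a `Gδ`-set in its
Stone–Čech compactification. -/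
structure IsCechComplete (X : Type*) [TopologicalSpace X] : Prop where
  tychonoff : T35Space X
  isGδ_range : IsGδ (range (stoneCechUnit : X → StoneCech X))

/-- A sieve on a space `X`: a sequence of indexed open covers `{U α : α ∈ A n}` of `X` together
with maps `π n : A (n + 1) → A n` such that every `U α`, `α ∈ A n`, is the union of
the sets `U β` with `π n β = α`. -/
structure SpaceSieve (X : Type u) [TopologicalSpace X] where
  /-- The index set of the `n`-th cover. -/
  A : ℕ → Type u
  /-- The members of the `n`-th cover. -/
  U : ∀ n, A n → Set X
  /-- The bonding maps between the index sets. -/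
  π : ∀ n, A (n + 1) → A n
  isOpen_U : ∀ n (α : A n), IsOpen (U n α)
  iUnion_U : ∀ n, ⋃ α : A n, U n α = univ
  U_eq : ∀ n (α : A n), U n α = ⋃ β ∈ {β : A (n + 1) | π n β = α}, U (n + 1) β

namespace SpaceSieve

variable {X : Type u} [TopologicalSpace X]

/-- A `π`-chain of the sieve. -/
def IsChain (S : SpaceSieve X) (α : ∀ n, S.A n) : Prop :=
  ∀ n, S.π n (α (n + 1)) = α n

/-- The sieve is complete if for every `π`-chain `(α n)`, every (proper) filter all of whose
members meet every `U (α n)` has a cluster point. (A filter base meshes with the sets `U (α n)`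
iff the filter that it generates does, and both have the same cluster points.) -/
def IsComplete (S : SpaceSieve X) : Prop :=
  ∀ α : ∀ n, S.A n, S.IsChain α →
    ∀ ℱ : Filter X, ℱ.NeBot → (∀ B ∈ ℱ, ∀ n, (B ∩ S.U n (α n)).Nonempty) →
      ∃ x, ClusterPt x ℱ

end SpaceSieve

/-- A space is sieve-complete if it has a complete sieve. -/
def IsSieveComplete (X : Type u) [TopologicalSpace X] : Prop :=
  ∃ S : SpaceSieve X, S.IsComplete

/-- A map `F : 𝒮(X) → 2^Y`, where `𝒮(X)` is a family of subsets of `X`, is set tri-quotient if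
there is a map `s` from the open sets of `X` to the open sets of `Y` with the four properties
below. -/
def IsSetTriQuotient {X Y 𝒮 : Type*} [TopologicalSpace X] [TopologicalSpace Y] [SetLike 𝒮 X]
    (F : 𝒮 → Set Y) : Prop :=
  ∃ s : Opens X → Opens Y,
    (∀ U : Opens X, (s U : Set Y) ⊆ ⋃ K ∈ {K : 𝒮 | (K : Set X) ⊆ U}, F K) ∧
    ((s ⊤ : Opens Y) : Set Y) = univ ∧
    (∀ U V : Opens X, (U : Set X) ⊆ V → (s U : Set Y) ⊆ s V) ∧
    (∀ (U : Opens X) (y : Y), y ∈ s U → ∀ 𝒲 : Set (Opens X),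
      (⋃ K ∈ {K : 𝒮 | y ∈ F K ∧ (K : Set X) ⊆ U}, (K : Set X)) ⊆ ⋃ W ∈ 𝒲, (W : Set X) →
      ∃ ℰ ⊆ 𝒲, ℰ.Finite ∧ y ∈ s (sSup ℰ))

/-! (a) ⇒ (b): refine the sieve to branches of open sets, each with closure inside the previous one.
Pairs of a branch and a point in all its sets form a subspace of (discrete)^ω × `Y`, whose
projection to `Y` is a continuous open surjection. By completeness of the sieve, a filter that fixes
every node has a cluster point (`isCompleteMapSeq_node`), and this makes the space paracompact and
Čech-complete.

(b) ⇒ (c): take F(K) = cl f(K) and s(U) = f(U).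

(c) ⇒ (a): let X be the intersection of open sets G_n of βX. The sets s(V_n), for decreasing V_n
with closure in G_n, form a sieve. Points y_n ∈ s(V_n) lie in F(K_n) with K_n ⊆ V_n; some compact L
contains all K_n, so F(L) contains all y_n. In a μ-space this gives completeness
(`IsMuSpace.exists_clusterPt`). -/

open Filter Topology

/-! ### Complete sequences of locally constant maps. -/

section Cylinders

variable {Z : Type*} {ι : ℕ → Type*} {g : ∀ n, Z → ι n}

/-- The points at which the first `n` maps `g i` take the prescribed values `c i`. -/
def cylinderSet (g : ∀ n, Z → ι n) (c : ∀ n, ι n) (n : ℕ) : Set Z :=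
  {z | ∀ i < n, g i z = c i}

theorem antitone_cylinderSet (g : ∀ n, Z → ι n) (c : ∀ n, ι n) : Antitone (cylinderSet g c) :=
  fun _ _ hmn _ hz i hi => hz i (hi.trans_le hmn)

theorem mem_cylinderSet_self (g : ∀ n, Z → ι n) (z : Z) (n : ℕ) :
    z ∈ cylinderSet g (fun i => g i z) n := fun _ _ => rfl

theorem cylinderSet_congr {c c' : ∀ n, ι n} {n : ℕ} (h : ∀ i < n, c i = c' i) :
    cylinderSet g c n = cylinderSet g c' n := by
  ext z
  exact forall₂_congr fun i hi => by rw [h i hi]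

variable [TopologicalSpace Z]

/-- A sequence of maps `g n : Z → ι n` is complete if every proper filter that contains a fibre of
each `g n` has a cluster point. -/
def IsCompleteMapSeq (g : ∀ n, Z → ι n) : Prop :=
  ∀ (c : ∀ n, ι n) (ℱ : Filter Z), ℱ.NeBot → (∀ n, g n ⁻¹' {c n} ∈ ℱ) → ∃ x, ClusterPt x ℱ

theorem isClopen_cylinderSet (hg : ∀ n, IsLocallyConstant (g n)) (c : ∀ n, ι n) (n : ℕ) :
    IsClopen (cylinderSet g c n) := by
  have : cylinderSet g c n = ⋂ i ∈ Finset.range n, g i ⁻¹' {c i} := by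
    ext z
    simp [cylinderSet]
  rw [this]
  exact isClopen_biInter_finset fun i _ => (hg i).isClopen_fiber (c i)

/-- The intersection of the cylinders is compact, so a finite subfamily covers it. If every cylinder
stuck out of that finite union, the remainders would generate a filter with a cluster point in the
intersection but outside the union. -/
theorem IsCompleteMapSeq.exists_cylinderSet_subset (hc : IsCompleteMapSeq g)
    (hg : ∀ n, IsLocallyConstant (g n)) {α : Type*} {s : α → Set Z} (hs : ∀ a, IsOpen (s a))
    (hcov : ⋃ a, s a = univ) (c : ∀ n, ι n) :
    ∃ n, ∃ E : Finset α, cylinderSet g c n ⊆ ⋃ a ∈ E, s a := by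
  have hclosed : IsClosed (⋂ n, cylinderSet g c n) :=
    isClosed_iInter fun n => (isClopen_cylinderSet hg c n).1
  have hcompact : IsCompact (⋂ n, cylinderSet g c n) := by
    intro ℱ hℱ hle
    obtain ⟨x, hx⟩ := hc c ℱ hℱ fun n => mem_of_superset (le_principal_iff.1 hle) fun z hz =>
      (mem_iInter.1 hz (n + 1)) n n.lt_succ_self
    exact ⟨x, isClosed_iff_clusterPt.1 hclosed x (hx.mono hle), hx⟩
  obtain ⟨E, hE⟩ := hcompact.elim_finite_subcover s hs (by rw [hcov]; exact subset_univ _)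
  by_contra! hne
  have hO : IsOpen (⋃ a ∈ E, s a) := isOpen_biUnion fun a _ => hs a
  have hanti : Antitone fun n => cylinderSet g c n \ ⋃ a ∈ E, s a := fun m n hmn =>
    sdiff_subset_sdiff_left (antitone_cylinderSet g c hmn)
  have hNB : (⨅ n, 𝓟 (cylinderSet g c n \ ⋃ a ∈ E, s a)).NeBot :=
    iInf_neBot_of_directed' (Antitone.directed_ge fun _ _ hmn => principal_mono.2 (hanti hmn))
      fun n => principal_neBot_iff.2 (sdiff_nonempty.2 (hne n E))
  have hmem : ∀ n, cylinderSet g c n \ (⋃ a ∈ E, s a) ∈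
      ⨅ n, 𝓟 (cylinderSet g c n \ ⋃ a ∈ E, s a) := fun n =>
    mem_iInf_of_mem n (mem_principal_self _)
  obtain ⟨x, hx⟩ := hc c _ hNB fun n => mem_of_superset (hmem (n + 1)) fun z hz =>
    hz.1 n n.lt_succ_self
  have hxn : ∀ n, x ∈ cylinderSet g c n \ ⋃ a ∈ E, s a := fun n =>
    isClosed_iff_clusterPt.1 ((isClopen_cylinderSet hg c n).1.sdiff hO) x
      (hx.mono (le_principal_iff.2 (hmem n)))
  exact (hxn 0).2 (hE (mem_iInter.2 fun n => (hxn n).1))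

/-- The shortest cylinders covered by finitely many members of the cover partition the space into
open blocks; each member is cut down to the blocks that use it. -/
theorem IsCompleteMapSeq.paracompactSpace (hc : IsCompleteMapSeq g)
    (hg : ∀ n, IsLocallyConstant (g n)) : ParacompactSpace Z := by
  classical
  refine ⟨fun α s hs hcov => ?_⟩
  have hex : ∀ z, ∃ n, ∃ E : Finset α, cylinderSet g (fun i => g i z) n ⊆ ⋃ a ∈ E, s a :=
    fun z => hc.exists_cylinderSet_subset hg hs hcov _
  -- The finite subfamily is chosen per set, not per point, so that all points of a block share it.
  obtain ⟨e, he⟩ : ∃ e : Set Z → Finset α, ∀ D, (∃ E : Finset α, D ⊆ ⋃ a ∈ E, s a) →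
      D ⊆ ⋃ a ∈ e D, s a := by
    have : ∀ D : Set Z, ∃ E : Finset α, (∃ E : Finset α, D ⊆ ⋃ a ∈ E, s a) →
        D ⊆ ⋃ a ∈ E, s a := fun D => by
      by_cases h : ∃ E : Finset α, D ⊆ ⋃ a ∈ E, s a
      · exact ⟨h.choose, fun _ => h.choose_spec⟩
      · exact ⟨∅, fun h' => (h h').elim⟩
    choose e he using this
    exact ⟨e, he⟩
  let N : Z → ℕ := fun z => Nat.find (hex z)
  let D : Z → Set Z := fun z => cylinderSet g (fun i => g i z) (N z)
  have hD : ∀ z, ∀ z' ∈ D z, D z' = D z := by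
    intro z z' hz'
    have hcyl : ∀ n ≤ N z, cylinderSet g (fun i => g i z') n = cylinderSet g (fun i => g i z) n :=
      fun n hn => cylinderSet_congr fun i hi => hz' i (hi.trans_le hn)
    have hN : N z' = N z := by
      refine (Nat.find_eq_iff _).2 ⟨?_, fun n hn => ?_⟩
      · rw [hcyl _ le_rfl]
        exact Nat.find_spec (hex z)
      · rw [hcyl _ hn.le]
        exact Nat.find_min (hex z) hn
    simp only [D]
    rw [hN]
    exact hcyl _ le_rfl
  have hDmem : ∀ z, z ∈ D z := fun z => mem_cylinderSet_self g z _
  have hDopen : ∀ z, IsOpen (D z) := fun z => (isClopen_cylinderSet hg _ _).2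
  refine ⟨α, fun a => {z | z ∈ s a ∧ a ∈ e (D z)}, fun a => ?_, ?_, fun z => ?_,
    fun a => ⟨a, fun z hz => hz.1⟩⟩
  · refine isOpen_iff_mem_nhds.2 fun z hz => ?_
    filter_upwards [(hs a).mem_nhds hz.1, (hDopen z).mem_nhds (hDmem z)] with z' h1 h2
    exact ⟨h1, by rw [hD z z' h2]; exact hz.2⟩
  · refine eq_univ_of_forall fun z => ?_
    obtain ⟨a, ha, hz⟩ := mem_iUnion₂.1 (he (D z) (Nat.find_spec (hex z)) (hDmem z))
    exact mem_iUnion.2 ⟨a, hz, ha⟩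
  · refine ⟨D z, (hDopen z).mem_nhds (hDmem z), (e (D z)).finite_toSet.subset ?_⟩
    rintro a ⟨z', ⟨-, h1⟩, h2⟩
    rwa [hD z z' h2] at h1

/-- Indicators of fibres extend to the compactification. If at p one extended indicator of each `g
n` is true, the trace of 𝓝 p contains those fibres, and its cluster point must be p. -/
theorem IsCompleteMapSeq.isCechComplete [T35Space Z] (hc : IsCompleteMapSeq g)
    (hg : ∀ n, IsLocallyConstant (g n)) : IsCechComplete Z := by
  classical
  refine ⟨inferInstance, ?_⟩
  have hχ : ∀ n (a : ι n), Continuous fun z => decide (g n z = a) := fun n a =>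
    ((hg n).comp fun b => decide (b = a)).continuous
  have hrange : range (stoneCechUnit : Z → StoneCech Z) =
      ⋂ n, ⋃ a, stoneCechExtend (hχ n a) ⁻¹' {true} := by
    refine Subset.antisymm ?_ fun p hp => ?_
    · rintro _ ⟨z, rfl⟩
      refine mem_iInter.2 fun n => mem_iUnion.2 ⟨g n z, ?_⟩
      simp [stoneCechExtend_stoneCechUnit]
    · choose c hcp using fun n => mem_iUnion.1 (mem_iInter.1 hp n)
      have hNB : (comap stoneCechUnit (𝓝 p) : Filter Z).NeBot :=
        isDenseInducing_stoneCechUnit.comap_nhds_neBot p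
      obtain ⟨x, hx⟩ := hc c _ hNB fun n => by
        refine ⟨_, ((isOpen_discrete _).preimage
          (continuous_stoneCechExtend (hχ n (c n)))).mem_nhds (hcp n), fun z hz => ?_⟩
        simpa [stoneCechExtend_stoneCechUnit] using hz
      have h1 : ClusterPt (stoneCechUnit x) (𝓝 p) :=
        hx.map continuous_stoneCechUnit.continuousAt tendsto_comap
      exact ⟨x, eq_of_nhds_neBot h1⟩
  rw [hrange]
  exact .iInter fun n => (isOpen_iUnion fun a =>
    (isOpen_discrete _).preimage (continuous_stoneCechExtend (hχ n a))).isGδ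

end Cylinders

/-! ### Permanence of complete regularity. -/

theorem T35Space.of_isEmbedding {X Y : Type*} [TopologicalSpace X] [TopologicalSpace Y]
    [T35Space Y] {f : X → Y} (hf : IsEmbedding f) : T35Space X :=
  have := hf.isInducing.completelyRegularSpace
  have := hf.t0Space
  { }

instance {X Y : Type*} [TopologicalSpace X] [TopologicalSpace Y] [CompletelyRegularSpace X]
    [CompletelyRegularSpace Y] : CompletelyRegularSpace (X × Y) :=
  completelyRegularSpace_inf (completelyRegularSpace_induced inferInstance _)
    (completelyRegularSpace_induced inferInstance _)

instance {ι : Type*} {X : ι → Type*} [∀ i, TopologicalSpace (X i)]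
    [∀ i, CompletelyRegularSpace (X i)] : CompletelyRegularSpace (∀ i, X i) :=
  completelyRegularSpace_iInf fun _ => completelyRegularSpace_induced inferInstance _

/-! ### The space of branches of a sieve. -/

namespace SpaceSieve

variable {Y : Type u} [TopologicalSpace Y] (S : SpaceSieve Y)

/-- An index of the sieve together with a subset of the space. -/
structure Node : Type u where
  /-- The level of the index. -/
  level : ℕ
  /-- The index. -/
  index : S.A level
  /-- The subset of the space. -/
  carrier : Set Y

instance : TopologicalSpace S.Node := ⊥

instance : DiscreteTopology S.Node := ⟨rfl⟩

/-- The node `t'` lies one level below `t`, and the closure of its open set is contained in the set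
of `t`. -/
inductive ShrinkStep : S.Node → S.Node → Prop
  | mk (n : ℕ) (β : S.A (n + 1)) (V V' : Set Y) (isOpen : IsOpen V')
      (closure_subset : closure V' ⊆ V) (subset_U : V' ⊆ S.U (n + 1) β) : ShrinkStep ⟨n, S.π n β, V⟩ ⟨n + 1, β, V'⟩

/-- A sequence of nodes that starts at level zero and shrinks at every step. -/
def IsBranch (t : ℕ → S.Node) : Prop :=
  (∃ α, t 0 = ⟨0, α, S.U 0 α⟩) ∧ ∀ n, S.ShrinkStep (t n) (t (n + 1))

/-- The points of `Y` together with the branches around them. -/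
structure BranchSpace : Type u where
  /-- The nodes of the branch. -/
  nodes : ℕ → S.Node
  /-- The point of `Y`. -/
  proj : Y
  isBranch : S.IsBranch nodes
  proj_mem : ∀ n, proj ∈ (nodes n).carrier

namespace BranchSpace

variable {S}

/-- The branch and the point as an element of a product. -/
def toProd (z : S.BranchSpace) : (ℕ → S.Node) × Y := (z.nodes, z.proj)

instance : TopologicalSpace S.BranchSpace := .induced toProd inferInstance

/-- The `n`-th node of the branch. -/
def node (n : ℕ) (z : S.BranchSpace) : S.Node := z.nodes n

theorem isEmbedding_toProd : IsEmbedding (toProd : S.BranchSpace → (ℕ → S.Node) × Y) := by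
  refine ⟨⟨rfl⟩, fun z z' h => ?_⟩
  cases z
  cases z'
  cases h
  rfl

theorem continuous_proj : Continuous (proj : S.BranchSpace → Y) :=
  continuous_snd.comp isEmbedding_toProd.continuous

theorem isLocallyConstant_node (n : ℕ) : IsLocallyConstant (node n : S.BranchSpace → S.Node) :=
  (IsLocallyConstant.iff_continuous _).2
    ((continuous_apply n).comp (continuous_fst.comp isEmbedding_toProd.continuous))

end BranchSpace

variable {S}

theorem ShrinkStep.isOpen_carrier {t t' : S.Node} (h : S.ShrinkStep t t') :
    IsOpen t'.carrier := by
  cases h; assumption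

theorem ShrinkStep.closure_carrier_subset {t t' : S.Node} (h : S.ShrinkStep t t') :
    closure t'.carrier ⊆ t.carrier := by
  cases h; assumption

theorem ShrinkStep.carrier_subset_U {t t' : S.Node} (h : S.ShrinkStep t t') :
    t'.carrier ⊆ S.U t'.level t'.index := by
  cases h; assumption

theorem IsBranch.isOpen_carrier {t : ℕ → S.Node} (h : S.IsBranch t) :
    ∀ n, IsOpen (t n).carrier
  | 0 => by
    obtain ⟨α, hα⟩ := h.1
    rw [hα]
    exact S.isOpen_U 0 α
  | n + 1 => (h.2 n).isOpen_carrier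

theorem IsBranch.carrier_subset_U {t : ℕ → S.Node} (h : S.IsBranch t) :
    ∀ n, (t n).carrier ⊆ S.U (t n).level (t n).index
  | 0 => by
    obtain ⟨α, hα⟩ := h.1
    rw [hα]
  | n + 1 => (h.2 n).carrier_subset_U

/-- Levels are stored as data so that all nodes share one type; induction along the branch recovers
that the `n`-th node has level `n`. -/
theorem IsBranch.exists_isChain {t : ℕ → S.Node} (h : S.IsBranch t) :
    ∃ α : ∀ n, S.A n, S.IsChain α ∧ ∀ n, (t n).carrier ⊆ S.U n (α n) := by
  have hlevel : ∀ n, ∃ a V, t n = ⟨n, a, V⟩ := by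
    intro n
    induction n with
    | zero => exact ⟨_, _, h.1.choose_spec⟩
    | succ n ih =>
      obtain ⟨a, V, ha⟩ := ih
      have h1 := h.2 n
      generalize t (n + 1) = t' at h1
      rw [ha] at h1
      cases h1
      exact ⟨_, _, rfl⟩
  choose α V hαV using hlevel
  refine ⟨α, fun n => ?_, fun n => ?_⟩
  · have h1 := h.2 n
    rw [hαV, hαV] at h1
    generalize α n = a at h1
    cases h1
    rfl
  · have h1 := h.carrier_subset_U n
    rwa [hαV] at h1 ⊢

theorem exists_shrinkStep [RegularSpace Y] {t : S.Node} (hopen : IsOpen t.carrier)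
    (hsub : t.carrier ⊆ S.U t.level t.index) {y : Y} (hy : y ∈ t.carrier) :
    ∃ t', S.ShrinkStep t t' ∧ y ∈ t'.carrier := by
  obtain ⟨n, α, V⟩ := t
  have hyU : y ∈ S.U n α := hsub hy
  rw [S.U_eq] at hyU
  obtain ⟨β, hβ, hyβ⟩ := mem_iUnion₂.1 hyU
  obtain rfl : S.π n β = α := hβ
  obtain ⟨C, ⟨hC, hCclosed⟩, hCsub⟩ := (closed_nhds_basis y).mem_iff.1
    ((hopen.inter (S.isOpen_U (n + 1) β)).mem_nhds ⟨hy, hyβ⟩)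
  refine ⟨⟨n + 1, β, interior C⟩, .mk n β V _ isOpen_interior ?_ ?_, mem_interior_iff_mem_nhds.2 hC⟩
  · exact (closure_minimal interior_subset hCclosed).trans (hCsub.trans inter_subset_left)
  · exact interior_subset.trans (hCsub.trans inter_subset_right)

theorem exists_shrinkStep_seq [RegularSpace Y] {t : S.Node} (hopen : IsOpen t.carrier)
    (hsub : t.carrier ⊆ S.U t.level t.index) {y : Y} (hy : y ∈ t.carrier) :
    ∃ w : ℕ → S.Node, w 0 = t ∧ (∀ n, S.ShrinkStep (w n) (w (n + 1))) ∧
      ∀ n, y ∈ (w n).carrier := by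
  let G := {t : S.Node // IsOpen t.carrier ∧ t.carrier ⊆ S.U t.level t.index ∧ y ∈ t.carrier}
  have hnext : ∀ t : G, ∃ t' : G, S.ShrinkStep t.1 t'.1 := fun t => by
    obtain ⟨t', hstep, hy'⟩ := exists_shrinkStep t.2.1 t.2.2.1 t.2.2.2
    exact ⟨⟨t', hstep.isOpen_carrier, hstep.carrier_subset_U, hy'⟩, hstep⟩
  choose next hnext using hnext
  refine ⟨fun n => (next^[n] ⟨t, hopen, hsub, hy⟩).1, rfl, fun n => ?_, fun n =>
    (next^[n] ⟨t, hopen, hsub, hy⟩).2.2.2⟩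
  beta_reduce
  rw [Function.iterate_succ_apply']
  exact hnext _

/-- Grafting: the nodes up to `n` are kept and continued by a fresh shrinking sequence around `y`.
-/
theorem IsBranch.exists_branch_eqOn [RegularSpace Y] {t : ℕ → S.Node} (h : S.IsBranch t) (n : ℕ)
    {y : Y} (hy : y ∈ (t n).carrier) :
    ∃ t', S.IsBranch t' ∧ (∀ k, y ∈ (t' k).carrier) ∧ ∀ i ≤ n, t' i = t i := by
  obtain ⟨w, hw0, hw, hyw⟩ := exists_shrinkStep_seq (h.isOpen_carrier n) (h.carrier_subset_U n) hy
  have hanti : Antitone fun k => (t k).carrier := antitone_nat_of_succ_le fun k =>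
    subset_closure.trans (h.2 k).closure_carrier_subset
  have hle : ∀ i ≤ n, (if i ≤ n then t i else w (i - n)) = t i := fun i hi => if_pos hi
  have hge : ∀ i, (if n + i ≤ n then t (n + i) else w (n + i - n)) = w i := by
    intro i
    rcases i.eq_zero_or_pos with rfl | hi
    · simp [hw0]
    · rw [if_neg (by omega), Nat.add_sub_cancel_left]
  refine ⟨fun i => if i ≤ n then t i else w (i - n), ⟨?_, fun k => ?_⟩, fun k => ?_, hle⟩
  · simpa using h.1
  · rcases lt_or_ge k n with hk | hk
    · beta_reduce
      rw [hle k hk.le, hle (k + 1) hk]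
      exact h.2 k
    · obtain ⟨i, rfl⟩ := Nat.exists_eq_add_of_le hk
      have h1 := hge (i + 1)
      rw [← add_assoc] at h1
      beta_reduce
      rw [hge, h1]
      exact hw i
  · beta_reduce
    rcases le_total k n with hk | hk
    · rw [hle k hk]
      exact hanti hk hy
    · obtain ⟨i, rfl⟩ := Nat.exists_eq_add_of_le hk
      rw [hge]
      exact hyw i

theorem BranchSpace.surjective_proj [RegularSpace Y] :
    Function.Surjective (proj : S.BranchSpace → Y) := by
  intro y
  obtain ⟨α, hα⟩ := mem_iUnion.1 ((S.iUnion_U 0).symm ▸ mem_univ y : y ∈ ⋃ α, S.U 0 α)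
  obtain ⟨w, hw0, hw, hyw⟩ := exists_shrinkStep_seq (S := S) (t := ⟨0, α, S.U 0 α⟩)
    (S.isOpen_U 0 α) Subset.rfl hα
  exact ⟨⟨w, y, ⟨⟨α, hw0⟩, hw⟩, hyw⟩, rfl⟩

/-- A basic neighbourhood restricts only finitely many nodes, and by grafting each point of the last
restricted set has a branch with these nodes. -/
theorem BranchSpace.isOpenMap_proj [RegularSpace Y] :
    IsOpenMap (proj : S.BranchSpace → Y) := by
  refine IsOpenMap.of_nhds_le fun z N hN => ?_
  obtain ⟨t, y, ht, hty⟩ := z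
  rw [mem_map, isEmbedding_toProd.nhds_eq_comap, mem_comap] at hN
  obtain ⟨O, hO, hON⟩ := hN
  obtain ⟨P, hP, Q, hQ, hPQ⟩ := mem_nhds_prod_iff.1 hO
  obtain ⟨n, hn⟩ : ∃ n, ∀ t' : ℕ → S.Node, (∀ i ≤ n, t' i = t i) → t' ∈ P := by
    rw [nhds_pi, Filter.mem_pi] at hP
    obtain ⟨I, hI, s, hs, hsP⟩ := hP
    obtain ⟨n, hn⟩ := hI.bddAbove
    refine ⟨n, fun t' ht' => hsP fun i hi => ?_⟩
    rw [ht' i (hn hi)]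
    exact mem_of_mem_nhds (hs i)
  filter_upwards [hQ, (ht.isOpen_carrier n).mem_nhds (hty n)] with y' hy' hyn
  obtain ⟨t', ht', hyt', heq⟩ := ht.exists_branch_eqOn n hyn
  exact hON (show toProd ⟨t', y', ht', hyt'⟩ ∈ O from hPQ ⟨hn t' heq, hy'⟩)

theorem IsComplete.isCompleteMapSeq_node (hS : S.IsComplete) :
    IsCompleteMapSeq (BranchSpace.node : ℕ → S.BranchSpace → S.Node) := by
  intro c ℱ hℱ hc
  have hbranch : S.IsBranch c := by
    refine ⟨?_, fun n => ?_⟩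
    · obtain ⟨z, hz⟩ := Filter.nonempty_of_mem (hc 0)
      have : z.nodes 0 = c 0 := hz
      exact this ▸ z.isBranch.1
    · obtain ⟨z, hz, hz'⟩ := Filter.nonempty_of_mem (inter_mem (hc n) (hc (n + 1)))
      have h1 : z.nodes n = c n := hz
      have h2 : z.nodes (n + 1) = c (n + 1) := hz'
      exact h1 ▸ h2 ▸ z.isBranch.2 n
  obtain ⟨α, hα, hsub⟩ := hbranch.exists_isChain
  have hmem : ∀ n, BranchSpace.proj ⁻¹' (c n).carrier ∈ ℱ := fun n =>
    mem_of_superset (hc n) fun z hz => by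
      have h1 : z.nodes n = c n := hz
      exact h1 ▸ z.proj_mem n
  obtain ⟨y, hy⟩ := hS α hα (map BranchSpace.proj ℱ) inferInstance fun B hB n => by
    obtain ⟨z, hzB, hz⟩ := Filter.nonempty_of_mem (inter_mem hB (hmem n))
    exact ⟨_, hzB, hsub n hz⟩
  obtain ⟨𝒰, h𝒰, hlim⟩ := mapClusterPt_iff_ultrafilter.1 hy
  -- The shrinking of closures keeps the limit `y` inside every set, so that it forms a point of the
  -- space with the branch `c`.
  have hyc : ∀ n, y ∈ (c n).carrier := fun n =>
    (hbranch.2 n).closure_carrier_subset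
      (mem_closure_of_tendsto hlim (h𝒰 (hmem (n + 1))))
  refine ⟨⟨c, y, hbranch, hyc⟩, ?_⟩
  have hle : (𝒰 : Filter S.BranchSpace) ≤ 𝓝 ⟨c, y, hbranch, hyc⟩ := by
    rw [BranchSpace.isEmbedding_toProd.nhds_eq_comap, ← tendsto_iff_comap, nhds_prod_eq]
    refine Tendsto.prodMk (tendsto_pi_nhds.2 fun n => ?_) hlim
    refine tendsto_nhds_of_eventually_eq ?_
    exact h𝒰 (hc n)
  exact NeBot.mono 𝒰.neBot (le_inf hle h𝒰)

end SpaceSieve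

theorem IsSieveComplete.exists_isOpenMap {Y : Type u} [TopologicalSpace Y] [T35Space Y]
    (h : IsSieveComplete Y) :
    ∃ (X : Type u) (_ : TopologicalSpace X), ParacompactSpace X ∧ IsCechComplete X ∧
      ∃ f : X → Y, Continuous f ∧ IsOpenMap f ∧ Function.Surjective f := by
  obtain ⟨S, hS⟩ := h
  have : T35Space ((ℕ → S.Node) × Y) := { }
  have : T35Space S.BranchSpace := .of_isEmbedding SpaceSieve.BranchSpace.isEmbedding_toProd
  have hc := hS.isCompleteMapSeq_node
  have hg := SpaceSieve.BranchSpace.isLocallyConstant_node (S := S)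
  exact ⟨S.BranchSpace, inferInstance, hc.paracompactSpace hg, hc.isCechComplete hg, _,
    SpaceSieve.BranchSpace.continuous_proj, SpaceSieve.BranchSpace.isOpenMap_proj,
    SpaceSieve.BranchSpace.surjective_proj⟩

/-! ### From a set tri-quotient map to a complete sieve. -/

/-- If the sets attached to the admissible nodes of
level zero cover `Y`, every set attached to a node is covered by the sets attached to its children,
and completeness holds along every branch, then `Y` is sieve-complete. -/
theorem IsSieveComplete.of_tree {Y T : Type u} [TopologicalSpace Y] (P : ℕ → T → Prop)
    (R : T → T → Prop) (O : T → Set Y) (hopen : ∀ t, IsOpen (O t))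
    (hmono : ∀ t t', R t t' → O t' ⊆ O t) (hzero : ∀ y, ∃ t, P 0 t ∧ y ∈ O t)
    (hsucc : ∀ n t y, P n t → y ∈ O t → ∃ t', P (n + 1) t' ∧ R t t' ∧ y ∈ O t')
    (hcomplete : ∀ t : ℕ → T, (∀ n, P n (t n)) → (∀ n, R (t n) (t (n + 1))) →
      ∀ ℱ : Filter Y, (∀ B ∈ ℱ, ∀ n, (B ∩ O (t n)).Nonempty) → ∃ y, ClusterPt y ℱ) :
    IsSieveComplete Y := by
  -- A node may have several parents under `R`; indexing by whole paths makes the parent unique.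
  let A : ℕ → Type u := fun n => {w : Fin (n + 1) → T //
    (∀ i : Fin (n + 1), P i (w i)) ∧ ∀ i : Fin n, R (w i.castSucc) (w i.succ)}
  let U : ∀ n, A n → Set Y := fun n w => O (w.1 (Fin.last n))
  let π : ∀ n, A (n + 1) → A n := fun n w => ⟨Fin.init w.1,
    fun i => w.2.1 i.castSucc, fun i => w.2.2 i.castSucc⟩
  have hU : ∀ n (α : A n), U n α = ⋃ β ∈ {β : A (n + 1) | π n β = α}, U (n + 1) β := by
    intro n α
    refine Subset.antisymm (fun y hy => ?_) (iUnion₂_subset fun β hβ => ?_)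
    · obtain ⟨t', hP, hR, hyt'⟩ := hsucc n _ y (α.2.1 (Fin.last n)) hy
      refine mem_iUnion₂.2 ⟨⟨Fin.snoc α.1 t', fun i => ?_, fun i => ?_⟩, ?_, ?_⟩
      · refine Fin.lastCases ?_ (fun i => ?_) i
        · simpa using hP
        · simpa using α.2.1 i
      · refine Fin.lastCases ?_ (fun i => ?_) i
        · simpa using hR
        · rw [Fin.succ_castSucc, Fin.snoc_castSucc, Fin.snoc_castSucc]
          exact α.2.2 i
      · exact Subtype.ext (Fin.init_snoc (α := fun _ => T) t' α.1)
      · simpa [U] using hyt'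
    · obtain rfl : π n β = α := hβ
      exact hmono _ _ (β.2.2 (Fin.last n))
  refine ⟨⟨A, U, π, fun n α => hopen _, fun n => ?_, hU⟩, fun α hα ℱ _ hmesh => ?_⟩
  · induction n with
    | zero =>
      refine eq_univ_of_forall fun y => ?_
      obtain ⟨t, hP, hy⟩ := hzero y
      refine mem_iUnion.2 ⟨⟨fun _ => t, fun i => ?_, fun i => i.elim0⟩, hy⟩
      rwa [Fin.val_eq_zero]
    | succ n ih =>
      refine eq_univ_of_forall fun y => ?_
      obtain ⟨α, hα⟩ := mem_iUnion.1 (ih.symm ▸ mem_univ y : y ∈ ⋃ α, U n α)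
      rw [hU] at hα
      obtain ⟨β, -, hβ⟩ := mem_iUnion₂.1 hα
      exact mem_iUnion.2 ⟨β, hβ⟩
  · refine hcomplete (fun n => (α n).1 (Fin.last n)) (fun n => (α n).2.1 (Fin.last n))
      (fun n => ?_) ℱ hmesh
    have h1 : (α n).1 (Fin.last n) = (α (n + 1)).1 (Fin.last n).castSucc := by
      rw [← hα n]
      rfl
    rw [h1]
    exact (α (n + 1)).2.2 (Fin.last n)

/-- If `V` is a decreasing sequence of sets whose closures in the Stone–Čech compactification
intersect inside the space, then compact sets `K n ⊆ V n` lie in a common compact set. -/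
theorem exists_isCompact_superset_iUnion {X : Type*} [TopologicalSpace X] [T35Space X]
    {V : ℕ → Set X} (hV : Antitone V)
    (hrange : ⋂ n, closure (stoneCechUnit '' V n) ⊆ range (stoneCechUnit : X → StoneCech X))
    {K : ℕ → Set X} (hK : ∀ n, IsCompact (K n)) (hKV : ∀ n, K n ⊆ V n) :
    ∃ L, IsCompact L ∧ ∀ n, K n ⊆ L := by
  have he := isEmbedding_stoneCechUnit (X := X)
  -- For `n ≤ i` the set `K i` lies in the closure of `V n`; for `n > i` it is in the finite union.
  -- A point of `C` in no `K i` lies in all the closures.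
  let C : Set (StoneCech X) := ⋂ n,
    (closure (stoneCechUnit '' V n) ∪ ⋃ i ∈ Finset.range n, stoneCechUnit '' K i)
  have hC : IsClosed C := isClosed_iInter fun n => isClosed_closure.union <|
    (Finset.range n).finite_toSet.isClosed_biUnion fun i _ =>
      ((hK i).image continuous_stoneCechUnit).isClosed
  have hCrange : C ⊆ range stoneCechUnit := by
    intro p hp
    by_cases h : ∃ i, p ∈ stoneCechUnit '' K i
    · obtain ⟨i, x, -, rfl⟩ := h
      exact mem_range_self x
    · refine hrange (mem_iInter.2 fun n => ?_)
      refine (mem_iInter.1 hp n).resolve_right fun h' => h ?_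
      obtain ⟨i, -, hi⟩ := mem_iUnion₂.1 h'
      exact ⟨i, hi⟩
  refine ⟨stoneCechUnit ⁻¹' C, he.isInducing.isCompact_preimage' hC.isCompact hCrange,
    fun i x hx => mem_iInter.2 fun n => ?_⟩
  rcases lt_or_ge i n with h | h
  · exact Or.inr (mem_iUnion₂.2 ⟨i, Finset.mem_range.2 h, x, hx, rfl⟩)
  · exact Or.inl (subset_closure ⟨x, hV h (hKV i hx), rfl⟩)

/-- In a `μ`-space, a decreasing sequence of sets `O n` such that every selection `y n ∈ O n`
lies in a compact set is complete. -/
theorem IsMuSpace.exists_clusterPt {Y : Type*} [TopologicalSpace Y] (hY : IsMuSpace Y)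
    {O : ℕ → Set Y} (hanti : Antitone O)
    (hsel : ∀ y : ℕ → Y, (∀ n, y n ∈ O n) → ∃ C, IsCompact C ∧ ∀ n, y n ∈ C)
    {ℱ : Filter Y} (hℱ : ∀ B ∈ ℱ, ∀ n, (B ∩ O n).Nonempty) : ∃ y, ClusterPt y ℱ := by
  have hD : IsCompact (⋂ n, closure (O n)) := by
    refine hY _ (isClosed_iInter fun n => isClosed_closure) fun f hf => ?_
    by_contra hunb
    have hlarge : ∀ n : ℕ, ∃ y ∈ O n, (n : ℝ) < |f y| := by
      intro n
      have : ∃ d ∈ ⋂ n, closure (O n), (n : ℝ) < |f d| := by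
        by_contra! h
        refine hunb (isBounded_iff_forall_norm_le.2 ⟨n, ?_⟩)
        rintro _ ⟨d, hd, rfl⟩
        exact h d hd
      obtain ⟨d, hd, hfd⟩ := this
      obtain ⟨y, hy, hyO⟩ := mem_closure_iff.1 (mem_iInter.1 hd n) {y | (n : ℝ) < |f y|}
        (isOpen_lt continuous_const hf.abs) hfd
      exact ⟨y, hyO, hy⟩
    choose y hyO hy using hlarge
    obtain ⟨C, hC, hyC⟩ := hsel y hyO
    obtain ⟨M, hM⟩ := isBounded_iff_forall_norm_le.1 (hC.image hf).isBounded
    obtain ⟨n, hn⟩ := exists_nat_gt M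
    exact absurd (hM _ ⟨_, hyC n, rfl⟩) (not_le.2 (hn.trans (hy n)))
  by_contra! hcl
  have hdisj : Disjoint (𝓝ˢ (⋂ n, closure (O n))) ℱ :=
    hD.disjoint_nhdsSet_left.2 fun x _ => by
      have := hcl x
      rwa [ClusterPt, not_neBot, ← disjoint_iff] at this
  obtain ⟨W, hW, B, hB, hWB⟩ := Filter.disjoint_iff.1 hdisj
  obtain ⟨W', hW', hDW, hWW⟩ := mem_nhdsSet_iff_exists.1 hW
  -- A selection inside `B` clusters at a point of the compact intersection, whose neighbourhood
  -- `W'` misses `B`.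
  choose y hyB hyO using hℱ B hB
  obtain ⟨C, hC, hyC⟩ := hsel y hyO
  obtain ⟨x, -, hx⟩ := hC.exists_mapClusterPt_of_frequently (l := atTop) (f := y)
    (Eventually.frequently (.of_forall hyC))
  have hxD : x ∈ ⋂ n, closure (O n) := mem_iInter.2 fun n =>
    mem_closure_iff_clusterPt.2 (ClusterPt.mono hx (tendsto_principal.2
      ((eventually_ge_atTop n).mono fun m hm => hanti hm (hyO m))))
  obtain ⟨n, hn⟩ := (hx.frequently (hW'.mem_nhds (hDW hxD))).exists
  exact disjoint_left.1 hWB (hWW hn) (hyB n)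

theorem IsMuSpace.isSieveComplete_of_isSetTriQuotient {X Y : Type u} [TopologicalSpace X]
    [TopologicalSpace Y] (hY : IsMuSpace Y) (hX : IsCechComplete X) {F : Compacts X → Compacts Y}
    (hmono : ∀ K L : Compacts X, (K : Set X) ⊆ L → (F K : Set Y) ⊆ F L)
    (hF : IsSetTriQuotient fun K : Compacts X => (F K : Set Y)) : IsSieveComplete Y := by
  have := hX.tychonoff
  obtain ⟨G, hG, hrange⟩ := isGδ_iff_eq_iInter_nat.1 hX.isGδ_range
  obtain ⟨s, hs1, hs2, hs3, hs4⟩ := hF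
  let P : ℕ → Opens X → Prop := fun n V => closure (stoneCechUnit '' (V : Set X)) ⊆ G n
  have hrefine : ∀ n (V : Opens X) (y : Y), y ∈ s V → ∃ V', P n V' ∧ V' ≤ V ∧ y ∈ s V' := by
    intro n V y hy
    -- The admissible open subsets of `V` cover all of `V`. Finiteness of `ℰ` lets closure commute
    -- with the union, so `P n` passes to `sSup ℰ`.
    obtain ⟨ℰ, hℰ, hfin, hyℰ⟩ := hs4 V y hy {V' | P n V' ∧ V' ≤ V} <| by
      refine (iUnion₂_subset fun K hK => hK.2 : _ ⊆ (V : Set X)).trans fun x hx => ?_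
      have hxG : stoneCechUnit x ∈ G n := mem_iInter.1 (hrange ▸ mem_range_self x) n
      obtain ⟨C, ⟨hC, hCclosed⟩, hCG⟩ := (closed_nhds_basis (stoneCechUnit x)).mem_iff.1
        ((hG n).mem_nhds hxG)
      refine mem_iUnion₂.2 ⟨V ⊓ ⟨stoneCechUnit ⁻¹' interior C,
        isOpen_interior.preimage continuous_stoneCechUnit⟩, ⟨?_, inf_le_left⟩, hx,
        mem_interior_iff_mem_nhds.2 hC⟩
      refine (closure_minimal ?_ hCclosed).trans hCG
      rintro _ ⟨z, hz, rfl⟩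
      exact interior_subset hz.2
    refine ⟨sSup ℰ, ?_, sSup_le fun V' hV' => (hℰ hV').2, hyℰ⟩
    simp only [P, Opens.coe_sSup, image_iUnion, hfin.closure_biUnion]
    exact iUnion₂_subset fun V' hV' => (hℰ hV').1
  refine IsSieveComplete.of_tree P (fun V V' => V' ≤ V) (fun V => (s V : Set Y))
    (fun V => (s V).isOpen) (fun V V' h => hs3 V' V h) (fun y => ?_) (fun n V y _ hy => ?_)
    fun V hP hR ℱ hmesh => ?_
  · obtain ⟨V, hV, -, hy⟩ := hrefine 0 ⊤ y (by rw [← SetLike.mem_coe, hs2]; exact mem_univ y)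
    exact ⟨V, hV, hy⟩
  · exact hrefine (n + 1) V y hy
  · have hanti : Antitone V := antitone_nat_of_succ_le hR
    refine hY.exists_clusterPt (fun m n h => hs3 _ _ (hanti h))
      (fun y hy => ?_) hmesh
    have hK : ∀ n, ∃ K : Compacts X, (K : Set X) ⊆ V n ∧ y n ∈ F K := fun n => by
      obtain ⟨K, hK, hyK⟩ := mem_iUnion₂.1 (hs1 (V n) (hy n))
      exact ⟨K, hK, hyK⟩
    choose K hKV hyK using hK
    obtain ⟨L, hL, hKL⟩ := exists_isCompact_superset_iUnion (V := fun n => (V n : Set X))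
      (fun m n h => hanti h) (hrange ▸ iInter_mono hP) (fun n => (K n).isCompact) hKV
    exact ⟨F ⟨L, hL⟩, (F ⟨L, hL⟩).isCompact, fun n => hmono (K n) ⟨L, hL⟩ (hKL n) (hyK n)⟩

/-! ### From an open map to a set tri-quotient map. -/

/-- An open surjection that maps compact sets to relatively compact sets induces a set tri-quotient
map between the families of compact sets. -/
theorem IsOpenMap.isSetTriQuotient_closure_image {X Y : Type*} [TopologicalSpace X]
    [TopologicalSpace Y] {f : X → Y} (hf : IsOpenMap f) (hsurj : Function.Surjective f)
    (hK : ∀ K : Set X, IsCompact K → IsCompact (closure (f '' K))) :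
    IsSetTriQuotient fun K : Compacts X =>
      ((⟨closure (f '' K), hK K K.isCompact⟩ : Compacts Y) : Set Y) := by
  -- Singletons suffice: a family covering the relevant compact sets has a member containing `x`,
  -- and that one member already serves as `ℰ`.
  have hmem : ∀ x, f x ∈ closure (f '' ({x} : Set X)) := fun x =>
    subset_closure (mem_image_of_mem f (mem_singleton x))
  refine ⟨fun U => ⟨f '' U, hf U U.isOpen⟩, ?_, ?_, fun U V h => image_mono h, ?_⟩
  · rintro U _ ⟨x, hx, rfl⟩
    exact mem_iUnion₂.2 ⟨⟨{x}, isCompact_singleton⟩, singleton_subset_iff.2 hx, hmem x⟩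
  · simpa using hsurj.range_eq
  · rintro U _ ⟨x, hx, rfl⟩ 𝒲 h𝒲
    obtain ⟨W, hW, hxW⟩ := mem_iUnion₂.1 (h𝒲 (mem_iUnion₂.2
      ⟨⟨{x}, isCompact_singleton⟩, ⟨hmem x, singleton_subset_iff.2 hx⟩, mem_singleton x⟩))
    exact ⟨{W}, singleton_subset_iff.2 hW, finite_singleton W, x, by simpa using hxW, rfl⟩

theorem corollary3p7 (Y : Type u) [TopologicalSpace Y] [T35Space Y] (hY : IsMuSpace Y) :
    List.TFAE [
      IsSieveComplete Y,
      ∃ (X : Type u) (_ : TopologicalSpace X), ParacompactSpace X ∧ IsCechComplete X ∧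
        ∃ f : X → Y, IsOpenMap f ∧ Function.Surjective f ∧
          ∀ K : Set X, IsCompact K → IsCompact (closure (f '' K)),
      ∃ (X : Type u) (_ : TopologicalSpace X), ParacompactSpace X ∧ IsCechComplete X ∧
        ∃ F : Compacts X → Compacts Y,
          (∀ K L : Compacts X, (K : Set X) ⊆ L → (F K : Set Y) ⊆ F L) ∧
          IsSetTriQuotient (fun K : Compacts X => (F K : Set Y))] := by
  tfae_have 1 → 2 := by
    intro h
    obtain ⟨X, _, hpara, hcech, f, hcont, hopen, hsurj⟩ := h.exists_isOpenMap
    exact ⟨X, _, hpara, hcech, f, hopen, hsurj, fun K hK => (hK.image hcont).closure⟩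
  tfae_have 2 → 3 := by
    rintro ⟨X, _, hpara, hcech, f, hopen, hsurj, hK⟩
    exact ⟨X, _, hpara, hcech, fun K => ⟨closure (f '' K), hK K K.isCompact⟩,
      fun K L h => closure_mono (image_mono h), hopen.isSetTriQuotient_closure_image hsurj hK⟩
  tfae_have 3 → 1 := by
    rintro ⟨X, _, -, hcech, F, hmono, hF⟩
    exact hY.isSieveComplete_of_isSetTriQuotient hcech hmono hF
  tfae_finish
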